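/- Let $r\ge 1$. For $k=1,\dots,r$ let $\Gamma_k$ be an oriented simple curve in $\mathbb{C}$ without its endpoints, bounded or unbounded (parametrized injectively and continuously by an open interval, with a non-zero derivative outside a countable set of parameters), and let $d\mu_k(t)=w_k(t)\,dt$ on $\Gamma_k$. Assume that $w_k$ is continuous along $\Gamma_k$, tends to $0$ at both ends of $\Gamma_k$, has absolutely convergent moments $\int_{\Gamma_k}t^m w_k(t)\,dt$ for all $m\ge 0$, and is differentiable along $\Gamma_k$ outside a countable set of parameters, with $w_k'=-v_k'w_k$ there, i.e. $v_k'$ is the derivative of $v_k=-\ln w_k$; off $\Gamma_k$, $v_k'$ denotes any extension of this function to $\mathbb{C}$. For $\vec n\in\mathbb{N}^r$ ($\mathbb N\ni 0$) put $|\vec n|=n_1+\dots+n_r$, and let $\vec e_j$ be the $j$-th unit vector, $\vec e_0=\vec 0$. Let $M_{\vec n}$ be the $|\vec n|\times|\vec n|$ matrix made of $r$ consecutive column blocks, the $j$-th of which has the entries $\int t^{i+q}\,d\mu_j(t)$, $0\le i<|\vec n|$, $0\le q<n_j$. Assume that all multi-indices are normal, i.e. $\det M_{\vec n}\neq 0$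 for all $\vec n\in\mathbb N^r$. Let $P_{\vec n}$ be the type II multiple orthogonal polynomial, i.e. the monic polynomial of degree $|\vec n|$ with $\int P_{\vec n}(t)t^k\,d\mu_j(t)=0$ for $0\le k<n_j$, $1\le j\le r$, and let $(A_{\vec n,1},\dots,A_{\vec n,r})$ be the type I polynomials, i.e. $\deg A_{\vec n,j}\le n_j-1$ (with $A_{\vec n,j}=0$ if $n_j=0$) and $\sum_{j}\int t^kA_{\vec n,j}(t)\,d\mu_j(t)$ equals $0$ for $0\le k\le|\vec n|-2$ and equals $1$ for $k=|\vec n|-1\ge 0$. Put $$a_{\vec n,j}=\frac{\int t^{n_j}P_{\vec n}(t)\,d\mu_j(t)}{\int t^{n_j-1}P_{\vec n-\vec e_j}(t)\,d\mu_j(t)}\quad(n_j\ge1),\qquad b_{\vec n,j}=\sum_{k=1}^r\int tP_{\vec n}(t)A_{\vec n+\vec e_j,k}(t)\,d\mu_k(t).$$ Fix $\vec n$ with $n_j\ge 1$ for all $j$ and fix $l\in\{1,\dots,r\}$. Let $\mathbf P_{\vec m}=(P_{\vec m},P_{\vec m-\vec e_1},\dots,P_{\vec m-\vec e_r})^T$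 for every $\vec m$ with all $m_j\ge1$. Let $W(\vec n+\vec e_l;x)=(W_{ij}(x))_{0\le i,j\le r}$ be the matrix polynomial of degree $1$ with $$W_{00}=x-b_{\vec n,l},\quad W_{0j}=-a_{\vec n,j},\quad W_{i0}=1,\quad W_{ij}=\delta_{i,j}\,\bigl(b_{\vec n-\vec e_j,j}-b_{\vec n-\vec e_j,l}\bigr)\qquad(1\le i,j\le r).$$ For every $\vec m$ with all $m_j\ge1$, let the ladder matrix $N(\vec m;x)=(N_{ij}(x))_{0\le i,j\le r}$ be given by $$N_{i0}(x)=\sum_{k=1}^r\int_{\Gamma_k}P_{\vec m-\vec e_i}(t)A_{\vec m,k}(t)\frac{v_k'(t)-v_k'(x)}{x-t}w_k(t)\,dt,$$ $$N_{ij}(x)=a_{\vec m,j}\sum_{k=1}^r\int_{\Gamma_k}P_{\vec m-\vec e_i}(t)A_{\vec m+\vec e_j,k}(t)\frac{v_k'(t)-v_k'(x)}{t-x}w_k(t)\,dt+v_i'(x)\,\delta_{i,j}\qquad(1\le j\le r).$$ Then the nearest-neighbour recurrences hold in the form $$\mathbf P_{\vec n+\vec e_l}(x)=W(\vec n+\vec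 e_l;x)\,\mathbf P_{\vec n}(x),$$ and, for every $x\in\mathbb C$ at which the integrals $\int_{\Gamma_k}t^m\frac{v_k'(t)-v_k'(x)}{x-t}w_k(t)\,dt$ ($1\le k\le r$, $m\ge0$) converge absolutely, the compatibility conditions $$N(\vec n+\vec e_l;x)\,W(\vec n+\vec e_l;x)=W'(\vec n+\vec e_l;x)+W(\vec n+\vec e_l;x)\,N(\vec n;x)$$ hold, where $W'$ is the entrywise derivative with respect to $x$. -/

import Mathlib

open scoped Matrix

noncomputable section

namespace MOP

/-! ### Curves, weights and moments -/

/-- An oriented simple curve in the complex plane without its endpoints (bounded or unbounded):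
an injective continuous curve on an open interval `(lo, hi)` of the extended real line which,
outside a countable set of parameters (corners), is differentiable with non-zero velocity. -/
structure Arc where
  lo : EReal
  hi : EReal
  lo_lt_hi : lo < hi
  curve : ℝ → ℂ
  continuousOn_curve : ContinuousOn curve {s : ℝ | lo < (s : EReal) ∧ (s : EReal) < hi}
  injOn_curve : Set.InjOn curve {s : ℝ | lo < (s : EReal) ∧ (s : EReal) < hi}
  regular : ∃ S : Set ℝ, S.Countable ∧
    ∀ s : ℝ, lo < (s : EReal) → (s : EReal) < hi → s ∉ S →
      DifferentiableAt ℝ curve s ∧ deriv curve s ≠ 0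

/-- The open parameter interval of the curve. -/
def Arc.params (Γ : Arc) : Set ℝ := {s : ℝ | Γ.lo < (s : EReal) ∧ (s : EReal) < Γ.hi}

/-- The parameter tends to the initial end of the curve. -/
def Arc.atStart (Γ : Arc) : Filter ℝ :=
  Filter.comap (fun s : ℝ => (s : EReal)) (nhdsWithin Γ.lo (Set.Ioi Γ.lo))

/-- The parameter tends to the terminal end of the curve. -/
def Arc.atEnd (Γ : Arc) : Filter ℝ :=
  Filter.comap (fun s : ℝ => (s : EReal)) (nhdsWithin Γ.hi (Set.Iio Γ.hi))

/-- Absolute convergence of `∫_Γ f(t) dt`. -/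
def Arc.CurveIntegrable (Γ : Arc) (f : ℂ → ℂ) : Prop :=
  MeasureTheory.IntegrableOn (fun s : ℝ => f (Γ.curve s) * deriv Γ.curve s) Γ.params

/-- The contour integral `∫_Γ f(t) dt`. -/
def Arc.integral (Γ : Arc) (f : ℂ → ℂ) : ℂ :=
  ∫ s in Γ.params, f (Γ.curve s) * deriv Γ.curve s

/-- The standing assumptions on one measure `dμ(t) = w(t) dt` on the curve `Γ`: `w` is continuous
along `Γ` and vanishes at both ends, all moments exist, and, outside a countable set of
parameters, `w` is differentiable along `Γ` with `w' = - v' w`; that is, `v'` is, along `Γ`, the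
derivative of `v = - ln w`.  The values of `v'` off `Γ` are those of an arbitrary extension (for
instance the analytic continuation); they only play a role when an expression involving `v'(x)`
is considered at a point `x` off `Γ`. -/
structure IsWeight (Γ : Arc) (w v' : ℂ → ℂ) : Prop where
  continuousOn_weight : ContinuousOn (fun s : ℝ => w (Γ.curve s)) Γ.params
  vanish_start : Filter.Tendsto (fun s : ℝ => w (Γ.curve s)) Γ.atStart (nhds 0)
  vanish_end : Filter.Tendsto (fun s : ℝ => w (Γ.curve s)) Γ.atEnd (nhds 0)
  moments : ∀ m : ℕ, Γ.CurveIntegrable (fun t => t ^ m * w t)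
  log_deriv : ∃ S : Set ℝ, S.Countable ∧ ∀ s ∈ Γ.params, s ∉ S →
    HasDerivAt (fun u : ℝ => w (Γ.curve u))
      (-(v' (Γ.curve s)) * w (Γ.curve s) * deriv Γ.curve s) s

/-- `∫ p dμ_k`, where `dμ_k(t) = w_k(t) dt` on the `k`-th curve. -/
def polyInt {r : ℕ} (Γ : Fin r → Arc) (w : Fin r → ℂ → ℂ) (k : Fin r) (p : Polynomial ℂ) : ℂ :=
  (Γ k).integral (fun t => p.eval t * w k t)

/-- The size `|n| = n₁ + ⋯ + n_r` of a multi-index. -/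
def size {r : ℕ} (n : Fin r → ℕ) : ℕ := ∑ j, n j

/-- The matrix of mixed moments `M_n`: the rows are indexed by `0, …, |n| - 1`, the columns come
in `r` consecutive blocks of widths `n₁, …, n_r`, and the entry in row `i` and in column `q` of
the `j`-th block is the moment of order `i + q` of `μ_j`. -/
def mixedMoments {r : ℕ} (Γ : Fin r → Arc) (w : Fin r → ℂ → ℂ) (n : Fin r → ℕ) :
    Matrix (Fin (∑ j, n j)) (Fin (∑ j, n j)) ℂ :=
  Matrix.of fun i c =>
    polyInt Γ w (finSigmaFinEquiv.symm c).1
      (Polynomial.X ^ ((i : ℕ) + ((finSigmaFinEquiv.symm c).2 : ℕ)))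

/-- The multi-index `n` is normal: `M_n` is not singular. -/
def IsNormal {r : ℕ} (Γ : Fin r → Arc) (w : Fin r → ℂ → ℂ) (n : Fin r → ℕ) : Prop :=
  (mixedMoments Γ w n).det ≠ 0

/-! ### Multiple orthogonal polynomials -/

/-- The defining conditions of the type II multiple orthogonal polynomial of index `n`. -/
def IsTypeII {r : ℕ} (Γ : Fin r → Arc) (w : Fin r → ℂ → ℂ) (n : Fin r → ℕ)
    (p : Polynomial ℂ) : Prop :=
  p.Monic ∧ p.natDegree = size n ∧
    ∀ j : Fin r, ∀ k < n j, polyInt Γ w j (p * Polynomial.X ^ k) = 0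

/-- The defining conditions of the type I multiple orthogonal polynomials of index `n`; here
`degree < n_j` means degree at most `n_j - 1`, and `A_j = 0` if `n_j = 0`. -/
def IsTypeI {r : ℕ} (Γ : Fin r → Arc) (w : Fin r → ℂ → ℂ) (n : Fin r → ℕ)
    (A : Fin r → Polynomial ℂ) : Prop :=
  (∀ j, (A j).degree < (n j : WithBot ℕ)) ∧
    (∀ k : ℕ, k + 1 < size n → ∑ j, polyInt Γ w j (Polynomial.X ^ k * A j) = 0) ∧
    (∀ k : ℕ, k + 1 = size n → ∑ j, polyInt Γ w j (Polynomial.X ^ k * A j) = 1)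

/-- The type II polynomial `P_n` (it exists and is unique when `n` is normal). -/
def P {r : ℕ} (Γ : Fin r → Arc) (w : Fin r → ℂ → ℂ) (n : Fin r → ℕ) : Polynomial ℂ :=
  Classical.epsilon (IsTypeII Γ w n)

/-- The type I polynomials `(A_{n,1}, …, A_{n,r})` (they exist and are unique when `n` is
normal). -/
def A {r : ℕ} (Γ : Fin r → Arc) (w : Fin r → ℂ → ℂ) (n : Fin r → ℕ) : Fin r → Polynomial ℂ :=
  Classical.epsilon (IsTypeI Γ w n)

/-- `n + e_j`. -/
def up {r : ℕ} (n : Fin r → ℕ) (j : Fin r) : Fin r → ℕ := n + Pi.single j 1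

/-- `n - e_j`; only used when `n_j ≥ 1`. -/
def down {r : ℕ} (n : Fin r → ℕ) (j : Fin r) : Fin r → ℕ := n - Pi.single j 1

/-- `n - e_i` for `i = 0, 1, …, r`, with `e_0 = 0`. -/
def down₀ {r : ℕ} (n : Fin r → ℕ) (i : Fin (r + 1)) : Fin r → ℕ :=
  Fin.cases n (fun j => down n j) i

/-! ### Recurrence coefficients and the two matrices -/

/-- The recurrence coefficient
`a_{n,j} = ∫ x^{n_j} P_n dμ_j / ∫ x^{n_j - 1} P_{n - e_j} dμ_j`, for `n_j ≥ 1`. -/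
def a {r : ℕ} (Γ : Fin r → Arc) (w : Fin r → ℂ → ℂ) (n : Fin r → ℕ) (j : Fin r) : ℂ :=
  polyInt Γ w j (Polynomial.X ^ n j * P Γ w n) /
    polyInt Γ w j (Polynomial.X ^ (n j - 1) * P Γ w (down n j))

/-- The recurrence coefficient `b_{n,j} = ∫ x P_n(x) Q_{n + e_j}(x) dμ(x)`, where
`Q_m dμ = ∑ₖ A_{m,k} dμ_k`. -/
def b {r : ℕ} (Γ : Fin r → Arc) (w : Fin r → ℂ → ℂ) (n : Fin r → ℕ) (j : Fin r) : ℂ :=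
  ∑ k, polyInt Γ w k (Polynomial.X * P Γ w n * A Γ w (up n j) k)

/-- The vector `(P_n, P_{n - e_1}, …, P_{n - e_r})`. -/
def vecP {r : ℕ} (Γ : Fin r → Arc) (w : Fin r → ℂ → ℂ) (n : Fin r → ℕ) :
    Fin (r + 1) → Polynomial ℂ :=
  fun i => P Γ w (down₀ n i)

/-- `B_{l,j}(n) = b_{n - e_j, j} - b_{n - e_j, l}`. -/
def B {r : ℕ} (Γ : Fin r → Arc) (w : Fin r → ℂ → ℂ) (n : Fin r → ℕ) (l j : Fin r) : ℂ :=
  b Γ w (down n j) j - b Γ w (down n j) l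

/-- The matrix polynomial `W(n + e_l; x)`: its first row is
`(x - b_{n,l}, -a_{n,1}, …, -a_{n,r})`, and its row `j = 1, …, r` has `1` in column `0`,
`B_{l,j}(n)` on the diagonal, and zeros elsewhere. -/
def W {r : ℕ} (Γ : Fin r → Arc) (w : Fin r → ℂ → ℂ) (n : Fin r → ℕ) (l : Fin r) :
    Matrix (Fin (r + 1)) (Fin (r + 1)) (Polynomial ℂ) :=
  Matrix.of fun i j =>
    Fin.cases
      (Fin.cases (Polynomial.X - Polynomial.C (b Γ w n l))
        (fun j' => -Polynomial.C (a Γ w n j')) j)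
      (fun i' => Fin.cases 1
        (fun j' => if i' = j' then Polynomial.C (B Γ w n l i') else 0) j)
      i

/-- The value of a matrix polynomial at `x`. -/
def evalMat {r : ℕ} (M : Matrix (Fin (r + 1)) (Fin (r + 1)) (Polynomial ℂ)) (x : ℂ) :
    Matrix (Fin (r + 1)) (Fin (r + 1)) ℂ :=
  M.map (Polynomial.eval x)

/-- The entrywise derivative of a matrix polynomial. -/
def derivMat {r : ℕ} (M : Matrix (Fin (r + 1)) (Fin (r + 1)) (Polynomial ℂ)) :
    Matrix (Fin (r + 1)) (Fin (r + 1)) (Polynomial ℂ) :=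
  M.map (fun p => Polynomial.derivative p)

/-- The ladder matrix `N(n; x)`, with rows and columns `0, 1, …, r`:
column `0` is `N_{i0} = ∑ₖ ∫ P_{n - e_i}(t) A_{n,k}(t) (v_k'(t) - v_k'(x)) / (x - t) w_k(t) dt`
and column `j ≥ 1` is
`N_{ij} = a_{n,j} ∑ₖ ∫ P_{n - e_i}(t) A_{n + e_j,k}(t) (v_k'(t) - v_k'(x)) / (t - x) w_k(t) dt
  + v_i'(x) δ_{ij}`. -/
def N {r : ℕ} (Γ : Fin r → Arc) (w v' : Fin r → ℂ → ℂ) (n : Fin r → ℕ) (x : ℂ) :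
    Matrix (Fin (r + 1)) (Fin (r + 1)) ℂ :=
  Matrix.of fun i j =>
    Fin.cases
      (∑ k, (Γ k).integral fun t =>
        (P Γ w (down₀ n i)).eval t * (A Γ w n k).eval t *
          ((v' k t - v' k x) / (x - t)) * w k t)
      (fun j' : Fin r =>
        a Γ w n j' * (∑ k, (Γ k).integral fun t =>
          (P Γ w (down₀ n i)).eval t * (A Γ w (up n j') k).eval t *
            ((v' k t - v' k x) / (t - x)) * w k t)
        + if i = j'.succ then v' j' x else 0)
      j

/-- The integrals that make up the ladder matrices at the point `x` converge absolutely: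
`t^m (v_k'(t) - v_k'(x)) / (x - t) w_k(t)` is integrable along the `k`-th curve, for all `k`
and `m`. -/
def IsLadderPoint {r : ℕ} (Γ : Fin r → Arc) (w v' : Fin r → ℂ → ℂ) (x : ℂ) : Prop :=
  ∀ (k : Fin r) (m : ℕ),
    (Γ k).CurveIntegrable (fun t => t ^ m * ((v' k t - v' k x) / (x - t)) * w k t)

end MOP

end

namespace MOP
open Polynomial

variable {r : ℕ} {Γ : Fin r → Arc} {w : Fin r → ℂ → ℂ} {L : Fin r → ℂ[X] →ₗ[ℂ] ℂ}

/-! ### Linear algebra of the mixed moments -/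

/-! Up to a diagonal matrix of values `v_k'(x)`, the ladder matrix is a Gram matrix: its entries are
`∑ₖ K k (vecP i * vecQ j k)`, where `K k` integrates against `(v_k'(t) - v_k'(x)) / (t - x) w_k(t)
dt` and `vecQ` collects the type I tuples with suitable signs and factors. The same `W` carries
`vecP` from `n` to `n + e_l` by left multiplication (`vecP_up`) and `vecQ` from `n + e_l` back to
`n` by right multiplication (`vecQ_eq_sum`).

Pair `vecP` at `n + e_l` with `vecQ` at `n` and expand either factor: this gives `W N` on one side
and `N W` on the other, if `W(t)` may be replaced by `W(x)`. Only the corner entry of `W` depends on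
`t`, so the error is `K k ((t - x) p)`, which integration by parts turns into `L k p' - v_k'(x) L k
p` (`IsWeight.functional_X_sub_C_mul`). Biorthogonality evaluates these errors (the `sum_ladder`
lemmas): the corner ones are minus the sizes of the two indices, whose difference gives `W'`, and
the others match the diagonal part of `N`. `compatibility` assembles this.

The recurrences come from uniqueness: by normality, a polynomial or tuple of small degree with
enough vanishing moments is zero. -/

lemma map_mul_X_pow_eq_sum (ℓ : ℂ[X] →ₗ[ℂ] ℂ) {p : ℂ[X]} {N : ℕ} (hp : p.degree < N) (q : ℕ) :
    ℓ (p * X ^ q) = ∑ i : Fin N, p.coeff i * ℓ (X ^ ((i : ℕ) + q)) := by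
  by_cases h0 : p = 0
  · simp [h0]
  have hN : p.natDegree < N := (Polynomial.natDegree_lt_iff_degree_lt h0).2 hp
  conv_lhs => rw [Polynomial.as_sum_range_C_mul_X_pow' p hN]
  rw [Finset.sum_mul, map_sum, Finset.sum_range]
  refine Finset.sum_congr rfl fun i _ => ?_
  rw [mul_assoc, ← pow_add, ← smul_eq_C_mul, map_smul, smul_eq_mul]

lemma vecMul_mixedMoments (hL : ∀ k, polyInt Γ w k = L k) (m : Fin r → ℕ) {p : ℂ[X]}
    (hp : p.degree < size m) (j : Fin r) (q : Fin (m j)) :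
    ((fun i : Fin (∑ j, m j) => p.coeff i) ᵥ* mixedMoments Γ w m) (finSigmaFinEquiv ⟨j, q⟩) =
      L j (p * X ^ (q : ℕ)) := by
  rw [map_mul_X_pow_eq_sum (L j) hp]
  simp only [Matrix.vecMul, dotProduct, mixedMoments, hL, Matrix.of_apply]
  exact congrArg (fun c : (j : Fin r) × Fin (m j) =>
    ∑ i : Fin (∑ j, m j), p.coeff i * L c.1 (X ^ ((i : ℕ) + c.2)))
    (finSigmaFinEquiv.symm_apply_apply ⟨j, q⟩)

lemma mixedMoments_mulVec (hL : ∀ k, polyInt Γ w k = L k) (m : Fin r → ℕ) {A : Fin r → ℂ[X]}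
    (hA : ∀ j, (A j).degree < m j) (i : Fin (∑ j, m j)) :
    (mixedMoments Γ w m *ᵥ fun c => (A (finSigmaFinEquiv.symm c).1).coeff
      (finSigmaFinEquiv.symm c).2) i = ∑ j, L j (X ^ (i : ℕ) * A j) := by
  have h : ∀ j, L j (X ^ (i : ℕ) * A j) =
      ∑ q : Fin (m j), L j (X ^ ((i : ℕ) + q)) * (A j).coeff q := by
    intro j
    rw [mul_comm, map_mul_X_pow_eq_sum (L j) (hA j)]
    refine Finset.sum_congr rfl fun q _ => ?_
    rw [mul_comm, add_comm]
  simp only [h, Matrix.mulVec, dotProduct]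
  rw [← Fintype.sum_sigma', ← Equiv.sum_comp finSigmaFinEquiv.symm]
  simp [mixedMoments, hL]

/-- The coefficient row of `p` lies in the left kernel of the invertible moment matrix. This
uniqueness principle proves the type II recurrences. -/
lemma eq_zero_of_orthogonal (hL : ∀ k, polyInt Γ w k = L k) {m : Fin r → ℕ}
    (hm : IsNormal Γ w m) {p : ℂ[X]} (hp : p.degree < size m)
    (h : ∀ j, ∀ k < m j, L j (p * X ^ k) = 0) : p = 0 := by
  have h0 : (fun i : Fin (∑ j, m j) => p.coeff i) = 0 := by
    refine Matrix.eq_zero_of_vecMul_eq_zero hm ?_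
    ext c
    obtain ⟨⟨j, q⟩, rfl⟩ := finSigmaFinEquiv.surjective c
    rw [vecMul_mixedMoments hL m hp, h j q q.2, Pi.zero_apply]
  ext i
  by_cases hi : i < ∑ j, m j
  · exact congrFun h0 ⟨i, hi⟩
  · rw [coeff_zero]
    refine coeff_eq_zero_of_degree_lt (hp.trans_le ?_)
    exact_mod_cast not_lt.1 hi

/-- The same principle for the right kernel; it proves the type I recurrences. -/
lemma eq_zero_of_dual_orthogonal (hL : ∀ k, polyInt Γ w k = L k) {m : Fin r → ℕ}
    (hm : IsNormal Γ w m) {A : Fin r → ℂ[X]} (hA : ∀ j, (A j).degree < m j)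
    (h : ∀ k < size m, ∑ j, L j (X ^ k * A j) = 0) : A = 0 := by
  have h0 : (fun c : Fin (∑ j, m j) => (A (finSigmaFinEquiv.symm c).1).coeff
      (finSigmaFinEquiv.symm c).2) = 0 := by
    refine Matrix.eq_zero_of_mulVec_eq_zero hm ?_
    ext i
    rw [mixedMoments_mulVec hL m hA, h i i.2, Pi.zero_apply]
  ext j i
  by_cases hi : i < m j
  · have h1 := congrFun h0 (finSigmaFinEquiv ⟨j, ⟨i, hi⟩⟩)
    rwa [finSigmaFinEquiv.symm_apply_apply] at h1
  · rw [Pi.zero_apply, coeff_zero]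
    refine coeff_eq_zero_of_degree_lt ((hA j).trans_le ?_)
    exact_mod_cast not_lt.1 hi

lemma coeff_sum_fin_C_mul_X_pow {N : ℕ} (u : Fin N → ℂ) (i : Fin N) :
    (∑ i : Fin N, C (u i) * X ^ (i : ℕ)).coeff i = u i := by
  simp [coeff_C_mul, coeff_X_pow, Fin.val_inj]

lemma exists_coeff_eq {N : ℕ} (u : Fin N → ℂ) :
    ∃ p : ℂ[X], p.degree < N ∧ ∀ i : Fin N, p.coeff i = u i := by
  refine ⟨∑ i : Fin N, C (u i) * X ^ (i : ℕ), ?_, coeff_sum_fin_C_mul_X_pow u⟩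
  rw [← mem_degreeLT]
  refine Submodule.sum_mem _ fun i _ => ?_
  rw [mem_degreeLT]
  exact (degree_C_mul_X_pow_le _ _).trans_lt (by exact_mod_cast i.2)

/-- The terms below the leading monomial solve a linear system with the invertible moment matrix
acting on row vectors. -/
lemma exists_isTypeII (hL : ∀ k, polyInt Γ w k = L k) {m : Fin r → ℕ}
    (hm : IsNormal Γ w m) : ∃ p, IsTypeII Γ w m p := by
  have hu : IsUnit (mixedMoments Γ w m) :=
    (Matrix.isUnit_iff_isUnit_det _).2 (isUnit_iff_ne_zero.2 hm)
  obtain ⟨u, hu⟩ := Matrix.vecMul_surjective_iff_isUnit.2 hu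
    (fun c => -L (finSigmaFinEquiv.symm c).1
      (X ^ size m * X ^ ((finSigmaFinEquiv.symm c).2 : ℕ)))
  obtain ⟨p, hp, hpu⟩ := exists_coeff_eq u
  refine ⟨X ^ size m + p, monic_X_pow_add hp, ?_, fun j k hk => ?_⟩
  · rw [natDegree_add_eq_left_of_degree_lt, natDegree_X_pow]
    rwa [degree_X_pow]
  · have h := vecMul_mixedMoments hL m hp j ⟨k, hk⟩
    dsimp only at hu
    rw [funext hpu, hu] at h
    dsimp only at h
    rw [finSigmaFinEquiv.symm_apply_apply] at h
    rw [hL, add_mul, map_add, ← h, add_neg_cancel]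

lemma exists_isTypeI (hL : ∀ k, polyInt Γ w k = L k) {m : Fin r → ℕ}
    (hm : IsNormal Γ w m) : ∃ A, IsTypeI Γ w m A := by
  have hu : IsUnit (mixedMoments Γ w m) :=
    (Matrix.isUnit_iff_isUnit_det _).2 (isUnit_iff_ne_zero.2 hm)
  obtain ⟨v, hv⟩ := Matrix.mulVec_surjective_iff_isUnit.2 hu
    (fun i => if (i : ℕ) + 1 = size m then 1 else 0)
  choose A hA hAv using fun j => exists_coeff_eq fun q : Fin (m j) => v (finSigmaFinEquiv ⟨j, q⟩)
  have hvA : (fun c => (A (finSigmaFinEquiv.symm c).1).coeff (finSigmaFinEquiv.symm c).2) = v := by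
    ext c
    rw [hAv, Equiv.apply_symm_apply]
  have key : ∀ k < size m, ∑ j, L j (X ^ k * A j) = if k + 1 = size m then 1 else 0 := by
    intro k hk
    rw [← mixedMoments_mulVec hL m hA ⟨k, hk⟩, hvA, hv]
  refine ⟨A, hA, fun k hk => ?_, fun k hk => ?_⟩
  · simp only [hL]
    rw [key k (by omega), if_neg hk.ne]
  · simp only [hL]
    rw [key k (by omega), if_pos hk]

lemma isTypeII_P (hL : ∀ k, polyInt Γ w k = L k) (hnormal : ∀ m, IsNormal Γ w m)
    (m : Fin r → ℕ) : IsTypeII Γ w m (P Γ w m) :=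
  Classical.epsilon_spec (exists_isTypeII hL (hnormal m))

lemma isTypeI_A (hL : ∀ k, polyInt Γ w k = L k) (hnormal : ∀ m, IsNormal Γ w m)
    (m : Fin r → ℕ) : IsTypeI Γ w m (A Γ w m) :=
  Classical.epsilon_spec (exists_isTypeI hL (hnormal m))

end MOP

namespace MOP
open Polynomial

variable {r : ℕ} {Γ : Fin r → Arc} {w : Fin r → ℂ → ℂ} {L : Fin r → ℂ[X] →ₗ[ℂ] ℂ}

/-! ### Multi-indices -/

lemma up_same (m : Fin r → ℕ) (j : Fin r) : up m j j = m j + 1 := by simp [up]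

lemma up_of_ne (m : Fin r → ℕ) {i j : Fin r} (h : i ≠ j) : up m j i = m i := by simp [up, h]

lemma le_up (m : Fin r → ℕ) (i j : Fin r) : m i ≤ up m j i := by simp [up]

lemma down_same (m : Fin r → ℕ) (j : Fin r) : down m j j = m j - 1 := by simp [down]

lemma down_of_ne (m : Fin r → ℕ) {i j : Fin r} (h : i ≠ j) : down m j i = m i := by
  simp [down, h]

lemma up_comm (m : Fin r → ℕ) (i j : Fin r) : up (up m i) j = up (up m j) i :=
  add_right_comm _ _ _

lemma down_up (m : Fin r → ℕ) (j : Fin r) : down (up m j) j = m := by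
  ext i
  simp [down, up]

lemma up_down {m : Fin r → ℕ} {j : Fin r} (h : 1 ≤ m j) : up (down m j) j = m := by
  ext i
  rcases eq_or_ne i j with rfl | hi
  · rw [up_same, down_same]; omega
  · rw [up_of_ne _ hi, down_of_ne _ hi]

lemma down_up_comm {m : Fin r → ℕ} {j : Fin r} (h : 1 ≤ m j) (l : Fin r) :
    down (up m l) j = up (down m j) l := by
  nth_rewrite 1 [← up_down h]
  rw [up_comm, down_up]

lemma size_up (m : Fin r → ℕ) (j : Fin r) : size (up m j) = size m + 1 := by
  simp [size, up, Finset.sum_add_distrib]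

lemma size_down {m : Fin r → ℕ} {j : Fin r} (h : 1 ≤ m j) : size (down m j) + 1 = size m := by
  rw [← size_up, up_down h]

/-! ### Degrees and orthogonality -/

lemma map_eq_sum (ℓ : ℂ[X] →ₗ[ℂ] ℂ) {p : ℂ[X]} {N : ℕ} (hp : p.degree < N) :
    ℓ p = ∑ i : Fin N, p.coeff i * ℓ (X ^ (i : ℕ)) := by
  simpa using map_mul_X_pow_eq_sum ℓ hp 0

lemma degree_lt_of_coeff_eq_zero {p : ℂ[X]} {N : ℕ} (hp : p.degree < (N + 1 : ℕ))
    (h : p.coeff N = 0) : p.degree < N := by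
  rw [degree_lt_iff_coeff_zero] at hp ⊢
  intro i hi
  rcases hi.eq_or_lt with rfl | hi
  · exact h
  · exact hp i hi

/-- Once the lower moments vanish, `p` and its leading monomial pair equally with `D`. So the last
moment may be tested with a convenient monic polynomial. -/
lemma sum_map_X_pow_mul_eq_zero {D : Fin r → ℂ[X]} {p : ℂ[X]} {d : ℕ}
    (hp : p.degree < (d + 1 : ℕ)) (hd : p.coeff d = 1)
    (hlow : ∀ q < d, ∑ k, L k (X ^ q * D k) = 0) (h : ∑ k, L k (p * D k) = 0) :
    ∑ k, L k (X ^ d * D k) = 0 := by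
  have h1 := map_eq_sum (∑ k, L k ∘ₗ LinearMap.mulRight ℂ (D k)) hp
  simp only [LinearMap.sum_apply, LinearMap.comp_apply, LinearMap.mulRight_apply] at h1
  rw [h, Fin.sum_univ_castSucc, Finset.sum_eq_zero, zero_add, Fin.val_last, hd, one_mul] at h1
  · exact h1.symm
  · intro i _
    rw [hlow (i.castSucc : ℕ) i.2, mul_zero]

lemma degree_lt_of_lt_of_le {p : ℂ[X]} {M N : ℕ} (hp : p.degree < M) (h : M ≤ N) :
    p.degree < N := hp.trans_le (by exact_mod_cast h)

lemma degree_X_mul_lt {p : ℂ[X]} {N : ℕ} (hp : p.degree < N) : (X * p).degree < ((N + 1 : ℕ) : WithBot ℕ) := by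
  rw [degree_lt_iff_coeff_zero] at hp ⊢
  intro i hi
  obtain ⟨i, rfl⟩ : ∃ k, i = k + 1 := ⟨i - 1, by omega⟩
  rw [coeff_X_mul]
  exact hp i (by omega)

lemma degree_C_mul_lt {p : ℂ[X]} {N : ℕ} (hp : p.degree < N) (c : ℂ) :
    (C c * p).degree < N := by
  rw [degree_lt_iff_coeff_zero] at hp ⊢
  intro i hi
  rw [coeff_C_mul, hp i hi, mul_zero]

lemma degree_sub_lt_of_lt {p q : ℂ[X]} {N : ℕ} (hp : p.degree < N) (hq : q.degree < N) :
    (p - q).degree < N := (degree_sub_le p q).trans_lt (max_lt hp hq)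

lemma degree_sum_lt {ι : Type*} (s : Finset ι) {p : ι → ℂ[X]} {N : ℕ}
    (hp : ∀ i ∈ s, (p i).degree < N) : (∑ i ∈ s, p i).degree < N := by
  rw [← mem_degreeLT]
  exact Submodule.sum_mem _ fun i hi => mem_degreeLT.2 (hp i hi)

section

variable (hL : ∀ k, polyInt Γ w k = L k) (hnormal : ∀ m, IsNormal Γ w m)
include hL hnormal

lemma monic_P (m : Fin r → ℕ) : (P Γ w m).Monic := (isTypeII_P hL hnormal m).1

lemma natDegree_P (m : Fin r → ℕ) : (P Γ w m).natDegree = size m :=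
  (isTypeII_P hL hnormal m).2.1

lemma degree_P_lt (m : Fin r → ℕ) : (P Γ w m).degree < (size m + 1 : ℕ) := by
  have h := degree_le_natDegree (p := P Γ w m)
  rw [natDegree_P hL hnormal] at h
  exact h.trans_lt (by exact_mod_cast Nat.lt_succ_self _)

lemma coeff_P_size (m : Fin r → ℕ) : (P Γ w m).coeff (size m) = 1 := by
  rw [← natDegree_P hL hnormal m]
  exact monic_P hL hnormal m

lemma degree_A_lt (m : Fin r → ℕ) (k : Fin r) : (A Γ w m k).degree < m k :=
  (isTypeI_A hL hnormal m).1 k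

lemma map_P_mul (m : Fin r → ℕ) (j : Fin r) {q : ℂ[X]} (hq : q.degree < m j) :
    L j (P Γ w m * q) = 0 := by
  have h := map_eq_sum (L j ∘ₗ LinearMap.mulLeft ℂ (P Γ w m)) hq
  simp only [LinearMap.comp_apply, LinearMap.mulLeft_apply] at h
  rw [h]
  refine Finset.sum_eq_zero fun i _ => ?_
  rw [← hL, (isTypeII_P hL hnormal m).2.2 j i i.2, mul_zero]

lemma map_P_mul_X_pow (m : Fin r → ℕ) (j : Fin r) {k : ℕ} (hk : k < m j) :
    L j (P Γ w m * X ^ k) = 0 := by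
  rw [← hL]
  exact (isTypeII_P hL hnormal m).2.2 j k hk

/-- The type I conditions, extended by linearity: only the monomial of degree `size m - 1` is seen.
-/
lemma sum_map_mul_A (m : Fin r → ℕ) {p : ℂ[X]} (hp : p.degree < size m) :
    ∑ k, L k (p * A Γ w m k) = p.coeff (size m - 1) := by
  have h := map_eq_sum (∑ k, L k ∘ₗ LinearMap.mulRight ℂ (A Γ w m k)) hp
  simp only [LinearMap.sum_apply, LinearMap.comp_apply, LinearMap.mulRight_apply] at h
  rw [h]
  obtain ⟨-, h0, h1⟩ := isTypeI_A hL hnormal m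
  simp only [hL] at h0 h1
  rcases Nat.eq_zero_or_pos (size m) with hs | hs
  -- For the empty index the truncated `size m - 1` is `0`, which is harmless because `p` must
  -- vanish.
  · rw [hs] at hp ⊢
    have : p = 0 := by
      rw [← degree_eq_bot]
      exact Nat.WithBot.lt_zero_iff.1 hp
    simp [this]
  · rw [Finset.sum_eq_single ⟨size m - 1, by omega⟩]
    · rw [h1 _ (by dsimp only; omega), mul_one]
    · intro i _ hi
      rw [h0 i, mul_zero]
      have : (i : ℕ) ≠ size m - 1 := fun h => hi (Fin.ext h)
      have := i.2
      omega
    · simp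

lemma sum_map_X_pow_mul_A (m : Fin r → ℕ) {q : ℕ} (hq : q < size m) :
    ∑ k, L k (X ^ q * A Γ w m k) = if q + 1 = size m then 1 else 0 := by
  rw [sum_map_mul_A hL hnormal m (by rw [degree_X_pow]; exact_mod_cast hq), coeff_X_pow]
  congr 1
  apply propext
  omega

/-- Biorthogonality for neighbouring indices, component by component. -/
lemma map_P_mul_A_up (m : Fin r → ℕ) (j k : Fin r) :
    L k (P Γ w m * A Γ w (up m j) k) = if k = j then 1 else 0 := by
  have h0 : ∀ k, k ≠ j → L k (P Γ w m * A Γ w (up m j) k) = 0 := fun k hk =>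
    map_P_mul hL hnormal m k (by simpa [up_of_ne m hk] using degree_A_lt hL hnormal (up m j) k)
  split_ifs with h
  · subst h
    have h1 := sum_map_mul_A hL hnormal (up m k) (p := P Γ w m)
      (by rw [size_up]; exact degree_P_lt hL hnormal m)
    rwa [size_up, Nat.add_sub_cancel, coeff_P_size hL hnormal, Finset.sum_eq_single k
      (fun i _ hi => h0 i hi) (by simp)] at h1
  · exact h0 k h

lemma map_P_mul_A (m : Fin r → ℕ) (k : Fin r) : L k (P Γ w m * A Γ w m k) = 0 :=
  map_P_mul hL hnormal m k (degree_A_lt hL hnormal m k)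

lemma map_P_mul_of_degree_lt_succ (m : Fin r → ℕ) (j : Fin r) {q : ℂ[X]}
    (hq : q.degree < (m j + 1 : ℕ)) :
    L j (P Γ w m * q) = q.coeff (m j) * L j (X ^ m j * P Γ w m) := by
  have h : (q - C (q.coeff (m j)) * X ^ m j).degree < ((m j : ℕ) : WithBot ℕ) := by
    refine degree_lt_of_coeff_eq_zero (degree_sub_lt_of_lt hq ?_) (by simp)
    exact (degree_C_mul_X_pow_le _ _).trans_lt (by exact_mod_cast Nat.lt_succ_self _)
  have h1 := map_P_mul hL hnormal m j h
  rw [mul_sub, map_sub, sub_eq_zero] at h1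
  rw [h1, mul_left_comm, ← smul_eq_C_mul, map_smul, smul_eq_mul, mul_comm (X ^ m j)]

/-- The norm of `P_m` with respect to the `j`-th measure is the inverse of the leading
coefficient of `A_{m + e_j, j}`. -/
lemma coeff_A_up_mul (m : Fin r → ℕ) (j : Fin r) :
    (A Γ w (up m j) j).coeff (m j) * L j (X ^ m j * P Γ w m) = 1 := by
  rw [← map_P_mul_of_degree_lt_succ hL hnormal m j, map_P_mul_A_up hL hnormal, if_pos rfl]
  simpa [up_same] using degree_A_lt hL hnormal (up m j) j

/-- Both norms in the quotient defining `a` are inverses of type I leading coefficients, by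
`coeff_A_up_mul`. -/
lemma a_mul_coeff {m : Fin r → ℕ} {j : Fin r} (hj : 1 ≤ m j) :
    a Γ w m j * (A Γ w (up m j) j).coeff (m j) = (A Γ w m j).coeff (m j - 1) := by
  have h1 := coeff_A_up_mul hL hnormal m j
  have h2 := coeff_A_up_mul hL hnormal (down m j) j
  rw [up_down hj, down_same] at h2
  rw [a, hL, eq_div_of_mul_eq (right_ne_zero_of_mul_eq_one h2) h2,
    eq_div_of_mul_eq (right_ne_zero_of_mul_eq_one h1) h1]
  have := right_ne_zero_of_mul_eq_one h1
  have := right_ne_zero_of_mul_eq_one h2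
  field_simp

lemma degree_X_mul_P_sub_lt (m : Fin r → ℕ) (l : Fin r) :
    (X * P Γ w m - P Γ w (up m l)).degree < ((size m + 1 : ℕ) : WithBot ℕ) := by
  refine degree_lt_of_coeff_eq_zero (degree_sub_lt_of_lt
    (degree_X_mul_lt (degree_P_lt hL hnormal m)) ?_) ?_
  · simpa [size_up] using degree_P_lt hL hnormal (up m l)
  · have := coeff_P_size hL hnormal (up m l)
    rw [size_up] at this
    rw [coeff_sub, coeff_X_mul, coeff_P_size hL hnormal, this, sub_self]

/-- Subtracting `P Γ w (up m l)` does not change the pairing with the type I tuple of the same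
index, and it lowers the degree enough for that tuple to read off a coefficient. -/
lemma b_eq_coeff (m : Fin r → ℕ) (l : Fin r) :
    b Γ w m l = (X * P Γ w m - P Γ w (up m l)).coeff (size m) := by
  have h := sum_map_mul_A hL hnormal (up m l) (p := X * P Γ w m - P Γ w (up m l))
    (by rw [size_up]; exact degree_X_mul_P_sub_lt hL hnormal m l)
  rw [size_up, Nat.add_sub_cancel] at h
  rw [← h, b]
  refine Finset.sum_congr rfl fun k _ => ?_
  rw [hL, sub_mul, map_sub, map_P_mul_A hL hnormal, sub_zero]

/-! ### The nearest-neighbour recurrences -/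

lemma P_up_sub_P_up (m : Fin r → ℕ) (i l : Fin r) :
    P Γ w (up m l) - P Γ w (up m i) = C (b Γ w m i - b Γ w m l) * P Γ w m := by
  rw [← sub_eq_zero]
  have hd : P Γ w (up m l) - P Γ w (up m i) =
      (X * P Γ w m - P Γ w (up m i)) - (X * P Γ w m - P Γ w (up m l)) := by ring
  refine eq_zero_of_orthogonal hL (hnormal m) ?_ fun j k hk => ?_
  · refine degree_lt_of_coeff_eq_zero (degree_sub_lt_of_lt ?_
      (degree_C_mul_lt (degree_P_lt hL hnormal m) _)) ?_
    · rw [hd]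
      exact degree_sub_lt_of_lt (degree_X_mul_P_sub_lt hL hnormal m i)
        (degree_X_mul_P_sub_lt hL hnormal m l)
    · rw [coeff_sub, coeff_C_mul, coeff_P_size hL hnormal, b_eq_coeff hL hnormal,
        b_eq_coeff hL hnormal, hd, coeff_sub]
      ring
  · rw [sub_mul, sub_mul, map_sub, map_sub, mul_assoc, ← smul_eq_C_mul, map_smul,
      map_P_mul_X_pow hL hnormal _ _ (hk.trans_le (le_up m j l)),
      map_P_mul_X_pow hL hnormal _ _ (hk.trans_le (le_up m j i)),
      map_P_mul_X_pow hL hnormal _ _ hk]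
    simp

lemma P_up_down {m : Fin r → ℕ} {i : Fin r} (hi : 1 ≤ m i) (l : Fin r) :
    P Γ w (down (up m l) i) = P Γ w m + C (B Γ w m l i) * P Γ w (down m i) := by
  have h := P_up_sub_P_up hL hnormal (down m i) i l
  rw [up_down hi, ← down_up_comm hi] at h
  rw [B, ← h]
  ring

lemma P_up {m : Fin r → ℕ} (hm : ∀ j, 1 ≤ m j) (l : Fin r) :
    P Γ w (up m l) = (X - C (b Γ w m l)) * P Γ w m - ∑ j, C (a Γ w m j) * P Γ w (down m j) := by
  rw [eq_comm, ← sub_eq_zero]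
  refine eq_zero_of_orthogonal hL (hnormal m) ?_ fun i k hk => ?_
  · have e : (X - C (b Γ w m l)) * P Γ w m - ∑ j, C (a Γ w m j) * P Γ w (down m j)
        - P Γ w (up m l) = (X * P Γ w m - P Γ w (up m l) - C (b Γ w m l) * P Γ w m)
        - ∑ j, C (a Γ w m j) * P Γ w (down m j) := by ring
    rw [e]
    refine degree_sub_lt_of_lt (degree_lt_of_coeff_eq_zero (degree_sub_lt_of_lt
      (degree_X_mul_P_sub_lt hL hnormal m l) (degree_C_mul_lt (degree_P_lt hL hnormal m) _)) ?_)
      (degree_sum_lt _ fun j _ => degree_C_mul_lt ?_ _)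
    · rw [coeff_sub, coeff_C_mul, coeff_P_size hL hnormal, b_eq_coeff hL hnormal]
      ring
    · rw [← size_down (hm j)]
      exact degree_P_lt hL hnormal _
  · have e : ((X - C (b Γ w m l)) * P Γ w m - ∑ j, C (a Γ w m j) * P Γ w (down m j)
        - P Γ w (up m l)) * X ^ k = P Γ w m * X ^ (k + 1) - b Γ w m l • (P Γ w m * X ^ k)
        - ∑ j, a Γ w m j • (P Γ w (down m j) * X ^ k) - P Γ w (up m l) * X ^ k := by
      simp only [smul_eq_C_mul, sub_mul, Finset.sum_mul]
      congr 2
      · ring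
      · exact Finset.sum_congr rfl fun j _ => by ring
    rw [e, map_sub, map_sub, map_sub, map_sum, map_smul, map_P_mul_X_pow hL hnormal _ _ hk,
      map_P_mul_X_pow hL hnormal _ _ (hk.trans_le (le_up m i l)), smul_zero, sub_zero, sub_zero,
      Finset.sum_eq_single i, map_smul, smul_eq_mul]
    -- Only the last moment `k = m i - 1` is not already zero term by term; there `a` is exactly the
    -- quotient that makes the two remaining terms cancel.
    · rcases (Nat.succ_le_of_lt hk).eq_or_lt with hk' | hk'
      · have h2 := coeff_A_up_mul hL hnormal (down m i) i
        rw [up_down (hm i), down_same] at h2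
        have h3 : k = m i - 1 := by omega
        have h4 : k + 1 = m i := hk'
        rw [a, hL, h4, h3, mul_comm (P Γ w (down m i)),
          div_mul_cancel₀ _ (right_ne_zero_of_mul_eq_one h2), mul_comm, sub_self]
      · rw [map_P_mul_X_pow hL hnormal m i hk', map_P_mul_X_pow hL hnormal (down m i) i
          (by rw [down_same]; omega)]
        simp
    · intro j _ hj
      rw [map_smul, map_P_mul_X_pow hL hnormal _ _ (by rwa [down_of_ne _ hj.symm]), smul_zero]
    · simp

/-! ### Nearest-neighbour recurrences for the type I polynomials. -/

/-- The recurrence for the type I polynomials with one step down. -/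
lemma X_mul_A_up {n : Fin r → ℕ} (l : Fin r) (hn : ∀ j, 1 ≤ n j) (k : Fin r) :
    X * A Γ w (up n l) k = A Γ w n k + C (b Γ w n l) * A Γ w (up n l) k
      + ∑ i, C (a Γ w (up n l) i) * A Γ w (up (up n l) i) k := by
  set m := up n l with hm
  have hm1 : ∀ j, 1 ≤ m j := fun j => (hn j).trans (le_up n j l)
  have hs : size m = size n + 1 := size_up n l
  set D : Fin r → ℂ[X] := fun k => X * A Γ w m k - (A Γ w n k + C (b Γ w n l) * A Γ w m k
      + ∑ i, C (a Γ w m i) * A Γ w (up m i) k) with hD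
  have hlin : ∀ p : ℂ[X], ∑ k, L k (p * D k) = ∑ k, L k (X * p * A Γ w m k)
      - (∑ k, L k (p * A Γ w n k) + b Γ w n l * ∑ k, L k (p * A Γ w m k)
        + ∑ i, a Γ w m i * ∑ k, L k (p * A Γ w (up m i) k)) := by
    intro p
    simp only [Finset.mul_sum]
    rw [Finset.sum_comm (s := Finset.univ) (t := Finset.univ), ← Finset.sum_add_distrib,
      ← Finset.sum_add_distrib, ← Finset.sum_sub_distrib]
    refine Finset.sum_congr rfl fun k _ => ?_
    have e : p * D k = X * p * A Γ w m k - (p * A Γ w n k + b Γ w n l • (p * A Γ w m k)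
        + ∑ i, a Γ w m i • (p * A Γ w (up m i) k)) := by
      simp only [hD, smul_eq_C_mul, mul_sub, mul_add, Finset.mul_sum]
      congr 1
      · ring
      · congr 1
        · ring
        · exact Finset.sum_congr rfl fun j _ => by ring
    rw [e]
    simp only [map_sub, map_add, map_sum, map_smul, smul_eq_mul]
  have hlow : ∀ q < size n, ∑ k, L k (X ^ q * D k) = 0 := by
    intro q hq
    rw [hlin, ← pow_succ', sum_map_X_pow_mul_A hL hnormal m (by omega),
      sum_map_X_pow_mul_A hL hnormal n hq, sum_map_X_pow_mul_A hL hnormal m (by omega),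
      Finset.sum_eq_zero]
    · have h1 : q + 1 + 1 = size m ↔ q + 1 = size n := by omega
      have h2 : ¬ q + 1 = size m := by omega
      simp [h1, h2]
    · intro i _
      rw [sum_map_X_pow_mul_A hL hnormal (up m i) (by rw [size_up]; omega), if_neg, mul_zero]
      rw [size_up]
      omega
  -- The last moment is tested with `P Γ w n` rather than a monomial: it annihilates the tuple at
  -- `n` and its pairing with `X * A` is `b` by definition.
  have htop : ∑ k, L k (P Γ w n * D k) = 0 := by
    have h1 := sum_map_mul_A hL hnormal m (p := P Γ w n)
      (by rw [hs]; exact degree_P_lt hL hnormal n)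
    rw [hs, Nat.add_sub_cancel, coeff_P_size hL hnormal] at h1
    have h2 : ∀ i, ∑ k, L k (P Γ w n * A Γ w (up m i) k) = 0 := by
      intro i
      rw [sum_map_mul_A hL hnormal (up m i), size_up, hs, Nat.add_sub_cancel,
        coeff_eq_zero_of_degree_lt (degree_P_lt hL hnormal n)]
      rw [size_up, hs]
      exact degree_lt_of_lt_of_le (degree_P_lt hL hnormal n) (by omega)
    rw [hlin, h1]
    simp only [h2, map_P_mul_A hL hnormal, b, hL, ← hm]
    simp
  have hdeg : ∀ k, (D k).degree < m k := by
    intro k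
    have hA := degree_A_lt hL hnormal
    refine degree_lt_of_coeff_eq_zero (degree_sub_lt_of_lt (degree_X_mul_lt (hA m k)) ?_) ?_
    · refine (degree_add_le _ _).trans_lt (max_lt ((degree_add_le _ _).trans_lt (max_lt ?_ ?_)) ?_)
      · exact degree_lt_of_lt_of_le (hA n k) ((le_up n k l).trans (Nat.le_succ _))
      · exact degree_C_mul_lt (degree_lt_of_lt_of_le (hA m k) (Nat.le_succ _)) _
      · refine degree_sum_lt _ fun i _ => degree_C_mul_lt (degree_lt_of_lt_of_le (hA _ k) ?_) _
        rcases eq_or_ne k i with rfl | h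
        · rw [up_same]
        · rw [up_of_ne _ h]
          exact Nat.le_succ _
    -- The coefficient of degree `m k` comes only from `X * A Γ w m k` and from the summand `i = k`;
    -- these cancel by `a_mul_coeff`.
    · obtain ⟨d, hd⟩ : ∃ d, m k = d + 1 := ⟨m k - 1, by have := hm1 k; omega⟩
      simp only [hD, coeff_sub, coeff_add, finsetSum_coeff, coeff_C_mul]
      rw [Finset.sum_eq_single k, a_mul_coeff hL hnormal (hm1 k),
        coeff_eq_zero_of_degree_lt (hA m k),
        coeff_eq_zero_of_degree_lt (degree_lt_of_lt_of_le (hA n k) (le_up n k l))]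
      · rw [hd, coeff_X_mul, Nat.add_sub_cancel]
        ring
      · intro i _ hi
        rw [coeff_eq_zero_of_degree_lt, mul_zero]
        have h := hA (up m i) k
        rwa [up_of_ne _ hi.symm] at h
      · simp
  have hzero : D = 0 := by
    refine eq_zero_of_dual_orthogonal hL (hnormal m) hdeg fun q hq => ?_
    rcases (show q < size n ∨ q = size n by omega) with h | rfl
    · exact hlow q h
    · exact sum_map_X_pow_mul_eq_zero (degree_P_lt hL hnormal n) (coeff_P_size hL hnormal n)
        hlow htop
  exact sub_eq_zero.1 (congrFun hzero k)

/-- The two leading coefficients are inverse norms of `P` at `n - e_j` and at `n + e_l - e_j`. By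
`P_up_down` these norms differ by the factor `B`, since `P Γ w n` is orthogonal to the monomial in
question. -/
lemma B_mul_coeff {n : Fin r → ℕ} {j l : Fin r} (hj : 1 ≤ n j) (hjl : j ≠ l) :
    B Γ w n l j * (A Γ w (up n l) j).coeff (n j - 1) = (A Γ w n j).coeff (n j - 1) := by
  have h1 := coeff_A_up_mul hL hnormal (down n j) j
  have h2 := coeff_A_up_mul hL hnormal (down (up n l) j) j
  have hj' : 1 ≤ up n l j := by rwa [up_of_ne _ hjl]
  rw [up_down hj, down_same] at h1
  rw [up_down hj', down_same, up_of_ne _ hjl, P_up_down hL hnormal hj, mul_add, map_add,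
    mul_comm (X ^ (n j - 1)), map_P_mul_X_pow hL hnormal n j (by omega), zero_add, mul_left_comm,
    ← smul_eq_C_mul, map_smul, smul_eq_mul] at h2
  have h3 := right_ne_zero_of_mul_eq_one h1
  refine mul_right_cancel₀ h3 ?_
  rw [h1]
  linear_combination h2

/-- The recurrence between type I polynomials of neighbouring indices of the same size. -/
lemma C_a_mul_A_up {n : Fin r → ℕ} {j : Fin r} (hj : 1 ≤ n j) (l k : Fin r) :
    C (a Γ w n j) * A Γ w (up n j) k = C (a Γ w n j) * A Γ w (up n l) k
      + C (B Γ w n l j * a Γ w (up n l) j) * A Γ w (up (up n l) j) k := by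
  rcases eq_or_ne j l with rfl | hjl
  · simp [B]
  have hA := degree_A_lt hL hnormal
  set D : Fin r → ℂ[X] := fun k => C (a Γ w n j) * A Γ w (up n j) k -
    (C (a Γ w n j) * A Γ w (up n l) k
      + C (B Γ w n l j * a Γ w (up n l) j) * A Γ w (up (up n l) j) k) with hD
  have hzero : D = 0 := by
    refine eq_zero_of_dual_orthogonal hL (hnormal (up n l)) (fun k => ?_) fun q hq => ?_
    · rcases eq_or_ne k j with rfl | hkj
      · rw [up_of_ne _ hjl]
        refine degree_lt_of_coeff_eq_zero (degree_sub_lt_of_lt (degree_C_mul_lt ?_ _)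
          ((degree_add_le _ _).trans_lt (max_lt (degree_C_mul_lt ?_ _) (degree_C_mul_lt ?_ _)))) ?_
        · simpa [up_same] using hA (up n k) k
        · exact degree_lt_of_lt_of_le (hA (up n l) k) (by rw [up_of_ne _ hjl]; exact Nat.le_succ _)
        · simpa [up_same, up_of_ne _ hjl] using hA (up (up n l) k) k
        -- The first and the last term both have top coefficient `(A Γ w n k).coeff (n k - 1)`; the
        -- middle term has too small a degree.
        · have h1 := a_mul_coeff hL hnormal (m := up n l) (j := k) (by rwa [up_of_ne _ hjl])
          rw [up_of_ne _ hjl] at h1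
          simp only [hD, coeff_sub, coeff_add, coeff_C_mul]
          rw [a_mul_coeff hL hnormal hj, mul_assoc, h1, B_mul_coeff hL hnormal hj hjl,
            coeff_eq_zero_of_degree_lt (p := A Γ w (up n l) k)]
          · ring
          · simpa [up_of_ne _ hjl] using hA (up n l) k
      · refine degree_sub_lt_of_lt (degree_C_mul_lt ?_ _)
          ((degree_add_le _ _).trans_lt (max_lt (degree_C_mul_lt ?_ _) (degree_C_mul_lt ?_ _)))
        · refine degree_lt_of_lt_of_le (hA (up n j) k) ?_
          rw [up_of_ne _ hkj]
          exact le_up n k l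
        · exact hA _ k
        · simpa [up_of_ne _ hkj] using hA (up (up n l) j) k
    · have e : ∑ k, L k (X ^ q * D k) = a Γ w n j * ∑ k, L k (X ^ q * A Γ w (up n j) k)
          - (a Γ w n j * ∑ k, L k (X ^ q * A Γ w (up n l) k) + B Γ w n l j * a Γ w (up n l) j *
            ∑ k, L k (X ^ q * A Γ w (up (up n l) j) k)) := by
        simp only [Finset.mul_sum]
        rw [← Finset.sum_add_distrib, ← Finset.sum_sub_distrib]
        refine Finset.sum_congr rfl fun k _ => ?_
        simp only [hD, mul_sub, mul_add, ← smul_eq_C_mul, mul_smul_comm, map_sub, map_add,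
          map_smul, smul_eq_mul]
      rw [size_up] at hq
      rw [e, sum_map_X_pow_mul_A hL hnormal _ (by rw [size_up]; omega),
        sum_map_X_pow_mul_A hL hnormal _ (by rw [size_up]; omega),
        sum_map_X_pow_mul_A hL hnormal _ (by rw [size_up, size_up]; omega)]
      simp only [size_up]
      rw [if_neg (show ¬ q + 1 = size n + 1 + 1 by omega)]
      ring
  exact sub_eq_zero.1 (congrFun hzero k)

end

end MOP

namespace MOP
open Polynomial MeasureTheory Filter Topology

/-! ### Integration along a curve -/

lemma Arc.isOpen_params (Γ : Arc) : IsOpen Γ.params :=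
  (isOpen_Ioo (a := Γ.lo) (b := Γ.hi)).preimage continuous_coe_real_ereal

lemma Arc.Icc_subset_params (Γ : Arc) {a b : ℝ} (ha : a ∈ Γ.params) (hb : b ∈ Γ.params) :
    Set.Icc a b ⊆ Γ.params := fun _ hs =>
  ⟨ha.1.trans_le (EReal.coe_le_coe_iff.2 hs.1), (EReal.coe_le_coe_iff.2 hs.2).trans_lt hb.2⟩

/-- Parameters that tend to the two ends of the curve, on both sides of a fixed parameter. -/
lemma Arc.exists_seq (Γ : Arc) : ∃ c ∈ Γ.params, ∃ a b : ℕ → ℝ,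
    (∀ n, a n ∈ Γ.params ∧ a n ≤ c) ∧ (∀ n, b n ∈ Γ.params ∧ c ≤ b n) ∧
      Tendsto a atTop Γ.atStart ∧ Tendsto b atTop Γ.atEnd := by
  obtain ⟨c, hc1, hc2⟩ := EReal.lt_iff_exists_real_btwn.1 Γ.lo_lt_hi
  obtain ⟨u, -, hu, hul⟩ := exists_seq_strictAnti_tendsto' hc1
  obtain ⟨v, -, hv, hvl⟩ := exists_seq_strictMono_tendsto' hc2
  have hu' : ∀ n, ((u n).toReal : EReal) = u n := fun n =>
    EReal.coe_toReal ((hu n).2.trans (EReal.coe_lt_top c)).ne ((bot_le.trans_lt (hu n).1).ne')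
  have hv' : ∀ n, ((v n).toReal : EReal) = v n := fun n =>
    EReal.coe_toReal ((hv n).2.trans_le le_top).ne ((EReal.bot_lt_coe c).trans (hv n).1).ne'
  refine ⟨c, ⟨hc1, hc2⟩, fun n => (u n).toReal, fun n => (v n).toReal, fun n => ⟨⟨?_, ?_⟩, ?_⟩,
    fun n => ⟨⟨?_, ?_⟩, ?_⟩, ?_, ?_⟩
  · rw [hu']; exact (hu n).1
  · rw [hu']; exact (hu n).2.trans hc2
  · rw [← EReal.coe_le_coe_iff, hu']; exact (hu n).2.le
  · rw [hv']; exact hc1.trans (hv n).1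
  · rw [hv']; exact (hv n).2
  · rw [← EReal.coe_le_coe_iff, hv']; exact (hv n).1.le
  · refine tendsto_comap_iff.2 (tendsto_nhdsWithin_iff.2 ⟨?_, Eventually.of_forall fun n => ?_⟩)
    · simpa only [Function.comp_def, hu'] using hul
    · exact (hu n).1.trans_eq (hu' n).symm
  · refine tendsto_comap_iff.2 (tendsto_nhdsWithin_iff.2 ⟨?_, Eventually.of_forall fun n => ?_⟩)
    · simpa only [Function.comp_def, hv'] using hvl
    · exact (hv' n).trans_lt (hv n).2

lemma Arc.eventually_lt_of_tendsto_atStart (Γ : Arc) {a : ℕ → ℝ} (ha : Tendsto a atTop Γ.atStart)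
    {s : ℝ} (hs : s ∈ Γ.params) : ∀ᶠ n in atTop, a n < s := by
  have h := (tendsto_comap_iff.1 ha).mono_right nhdsWithin_le_nhds
  filter_upwards [h.eventually (gt_mem_nhds hs.1)] with n hn
  exact EReal.coe_lt_coe_iff.1 hn

lemma Arc.eventually_lt_of_tendsto_atEnd (Γ : Arc) {b : ℕ → ℝ} (hb : Tendsto b atTop Γ.atEnd)
    {s : ℝ} (hs : s ∈ Γ.params) : ∀ᶠ n in atTop, s < b n := by
  have h := (tendsto_comap_iff.1 hb).mono_right nhdsWithin_le_nhds
  filter_upwards [h.eventually (lt_mem_nhds hs.2)] with n hn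
  exact EReal.coe_lt_coe_iff.1 hn

/-- The fundamental theorem of calculus along an exhaustion by compact intervals. -/
lemma Arc.tendsto_sub (Γ : Arc) {F f : ℝ → ℂ} (hF : ContinuousOn F Γ.params) {S : Set ℝ}
    (hS : S.Countable) (hd : ∀ s ∈ Γ.params, s ∉ S → HasDerivAt F (f s) s)
    (hf : IntegrableOn f Γ.params) {T : Set ℝ} (hT : MeasurableSet T) (hTp : T ⊆ Γ.params)
    {a b : ℕ → ℝ} (ha : ∀ n, a n ∈ Γ.params) (hb : ∀ n, b n ∈ Γ.params) (hab : ∀ n, a n ≤ b n)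
    (hsub : ∀ n, Set.Ioc (a n) (b n) ⊆ T)
    (hcover : ∀ s ∈ T, ∀ᶠ n in atTop, s ∈ Set.Ioc (a n) (b n)) :
    Tendsto (fun n => F (b n) - F (a n)) atTop (𝓝 (∫ s in T, f s)) := by
  have hc : AECover (volume.restrict T) atTop fun n => Set.Ioc (a n) (b n) :=
    ⟨(ae_restrict_iff' hT).2 (Eventually.of_forall hcover), fun n => measurableSet_Ioc⟩
  have h := hc.integral_tendsto_of_countably_generated (hf.mono_set hTp)
  refine h.congr fun n => ?_
  rw [Measure.restrict_restrict measurableSet_Ioc, Set.inter_eq_left.2 (hsub n),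
    ← intervalIntegral.integral_of_le (hab n)]
  have hI := Γ.Icc_subset_params (ha n) (hb n)
  refine integral_eq_of_hasDerivAt_off_countable_of_le F f (hab n) hS
    (hF.mono hI) (fun s hs => hd s (hI (Set.Ioo_subset_Icc_self hs.1)) hs.2) ?_
  exact (intervalIntegrable_iff_integrableOn_Icc_of_le (hab n)).2 (hf.mono_set hI)

/-- The integral of the derivatives of a family of functions vanishes if the products with a
function which vanishes at the ends stay in the family. -/
lemma Arc.integral_deriv_eq_zero (Γ : Arc) {F F₂ f f₂ g : ℝ → ℂ} {S : Set ℝ} (hS : S.Countable)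
    (hF : ContinuousOn F Γ.params) (hd : ∀ s ∈ Γ.params, s ∉ S → HasDerivAt F (f s) s)
    (hf : IntegrableOn f Γ.params)
    (hF₂ : ContinuousOn F₂ Γ.params) (hd₂ : ∀ s ∈ Γ.params, s ∉ S → HasDerivAt F₂ (f₂ s) s)
    (hf₂ : IntegrableOn f₂ Γ.params) (hg : ∀ s, F s * F s = F₂ s * g s)
    (h0 : Tendsto g Γ.atStart (𝓝 0)) (h1 : Tendsto g Γ.atEnd (𝓝 0)) :
    ∫ s in Γ.params, f s = 0 := by
  obtain ⟨c, hc, a, b, ha, hb, hal, hbl⟩ := Γ.exists_seq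
  have hR : ∀ {F f : ℝ → ℂ}, ContinuousOn F Γ.params →
      (∀ s ∈ Γ.params, s ∉ S → HasDerivAt F (f s) s) → IntegrableOn f Γ.params →
      Tendsto (fun n => F (b n) - F c) atTop (𝓝 (∫ s in Γ.params \ Set.Iic c, f s)) := by
    intro F f hF hd hf
    refine Γ.tendsto_sub hF hS hd hf (Γ.isOpen_params.measurableSet.diff measurableSet_Iic)
      Set.sdiff_subset (a := fun _ => c) (fun _ => hc) (fun n => (hb n).1) (fun n => (hb n).2)
      (fun n s hs => ⟨Γ.Icc_subset_params hc (hb n).1 ⟨hs.1.le, hs.2⟩, not_le.2 hs.1⟩)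
      fun s hs => ?_
    filter_upwards [Γ.eventually_lt_of_tendsto_atEnd hbl hs.1] with n hn
    exact ⟨not_le.1 hs.2, hn.le⟩
  have hl : ∀ {F f : ℝ → ℂ}, ContinuousOn F Γ.params →
      (∀ s ∈ Γ.params, s ∉ S → HasDerivAt F (f s) s) → IntegrableOn f Γ.params →
      Tendsto (fun n => F c - F (a n)) atTop (𝓝 (∫ s in Γ.params ∩ Set.Iic c, f s)) := by
    intro F f hF hd hf
    refine Γ.tendsto_sub hF hS hd hf (Γ.isOpen_params.measurableSet.inter measurableSet_Iic)
      Set.inter_subset_left (b := fun _ => c) (fun n => (ha n).1) (fun _ => hc)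
      (fun n => (ha n).2)
      (fun n s hs => ⟨Γ.Icc_subset_params (ha n).1 hc ⟨hs.1.le, hs.2⟩, hs.2⟩) fun s hs => ?_
    filter_upwards [Γ.eventually_lt_of_tendsto_atStart hal hs.1] with n hn
    exact ⟨hn, hs.2⟩
  -- Integrability of the derivatives gives finite end limits of `F` and `F₂`; then `F * F = F₂ * g`
  -- forces `y * y = y₂ * 0`.
  have hend : ∀ {u : ℕ → ℝ} {y y₂ : ℂ}, Tendsto (fun n => F (u n)) atTop (𝓝 y) →
      Tendsto (fun n => F₂ (u n)) atTop (𝓝 y₂) → Tendsto (fun n => g (u n)) atTop (𝓝 0) →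
      y = 0 := by
    intro u y y₂ hy hy₂ hgu
    have h := hy₂.mul hgu
    simp only [← hg, mul_zero] at h
    exact mul_self_eq_zero.1 (tendsto_nhds_unique (hy.mul hy) h)
  have e1 := hend (by simpa using (hR hF hd hf).add_const (F c))
    (by simpa using (hR hF₂ hd₂ hf₂).add_const (F₂ c)) (h1.comp hbl)
  have e2 := hend (by simpa using (hl hF hd hf).const_sub (F c))
    (by simpa using (hl hF₂ hd₂ hf₂).const_sub (F₂ c)) (h0.comp hal)
  rw [← integral_inter_add_sdiff measurableSet_Iic hf (t := Set.Iic c)]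
  linear_combination e1 - e2

/-! ### Moment functionals on a curve and integration by parts. -/

lemma Arc.CurveIntegrable.add {Γ : Arc} {f g : ℂ → ℂ} (hf : Γ.CurveIntegrable f)
    (hg : Γ.CurveIntegrable g) : Γ.CurveIntegrable fun t => f t + g t :=
  (Integrable.add hf hg).congr (Eventually.of_forall fun _ => (add_mul _ _ _).symm)

lemma Arc.CurveIntegrable.const_mul {Γ : Arc} {f : ℂ → ℂ} (hf : Γ.CurveIntegrable f) (c : ℂ) :
    Γ.CurveIntegrable fun t => c * f t :=
  (Integrable.const_mul hf c).congr (Eventually.of_forall fun _ => (mul_assoc _ _ _).symm)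

lemma Arc.curveIntegrable_eval_mul {Γ : Arc} {g : ℂ → ℂ}
    (hg : ∀ m : ℕ, Γ.CurveIntegrable fun t => t ^ m * g t) (p : ℂ[X]) :
    Γ.CurveIntegrable fun t => p.eval t * g t := by
  induction p using Polynomial.induction_on' with
  | add p q hp hq => simpa only [eval_add, add_mul] using hp.add hq
  | monomial m c => simpa only [eval_monomial, mul_assoc] using (hg m).const_mul c

/-- Integration of polynomials against a function with finite moments on a curve. -/
noncomputable def Arc.functional (Γ : Arc) (g : ℂ → ℂ) (hg : ∀ m : ℕ, Γ.CurveIntegrable fun t => t ^ m * g t) :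
    ℂ[X] →ₗ[ℂ] ℂ where
  toFun p := Γ.integral fun t => p.eval t * g t
  map_add' p q := by
    rw [Arc.integral, Arc.integral, Arc.integral, ← integral_add
      (Arc.curveIntegrable_eval_mul hg p) (Arc.curveIntegrable_eval_mul hg q)]
    simp only [eval_add, add_mul]
  map_smul' c p := by
    rw [Arc.integral, Arc.integral, RingHom.id_apply, smul_eq_mul, ← integral_const_mul]
    simp only [eval_smul, smul_eq_mul, mul_assoc]

lemma Arc.functional_apply (Γ : Arc) (g : ℂ → ℂ)
    (hg : ∀ m : ℕ, Γ.CurveIntegrable fun t => t ^ m * g t) (p : ℂ[X]) :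
    Γ.functional g hg p = Γ.integral fun t => p.eval t * g t := rfl

/-- A simple curve meets `x` for at most one parameter, so `t - x` can be cancelled under the
integral even when `x` lies on the curve. -/
lemma Arc.ae_curve_ne (Γ : Arc) (x : ℂ) :
    ∀ᵐ s ∂volume.restrict Γ.params, Γ.curve s ≠ x := by
  rw [ae_restrict_iff' Γ.isOpen_params.measurableSet]
  have h : {s | s ∈ Γ.params ∧ Γ.curve s = x}.Subsingleton := fun s hs t ht =>
    Γ.injOn_curve hs.1 ht.1 (hs.2.trans ht.2.symm)
  filter_upwards [h.countable.ae_notMem volume] with s hs hsp hx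
  exact hs ⟨hsp, hx⟩

/-- Integration by parts against a weight. -/
lemma IsWeight.integral_derivative {Γ : Arc} {w v' : ℂ → ℂ} (hw : IsWeight Γ w v')
    (hv : ∀ p : ℂ[X], Γ.CurveIntegrable fun t => p.eval t * (v' t * w t)) (p : ℂ[X]) :
    Γ.functional w hw.moments (derivative p) = Γ.integral fun t => p.eval t * (v' t * w t) := by
  obtain ⟨S₁, hS₁, h₁⟩ := Γ.regular
  obtain ⟨S₂, hS₂, h₂⟩ := hw.log_deriv
  have hc : ∀ p : ℂ[X], ContinuousOn (fun s => p.eval (Γ.curve s) * w (Γ.curve s)) Γ.params :=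
    fun p => (p.continuous.comp_continuousOn Γ.continuousOn_curve).mul hw.continuousOn_weight
  have hd : ∀ p : ℂ[X], ∀ s ∈ Γ.params, s ∉ S₁ ∪ S₂ →
      HasDerivAt (fun s => p.eval (Γ.curve s) * w (Γ.curve s))
        ((derivative p).eval (Γ.curve s) * w (Γ.curve s) * deriv Γ.curve s
          - p.eval (Γ.curve s) * (v' (Γ.curve s) * w (Γ.curve s)) * deriv Γ.curve s) s := by
    intro p s hs hsS
    rw [Set.mem_union, not_or] at hsS
    have hγ := (h₁ s hs.1 hs.2 hsS.1).1.hasDerivAt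
    have h := ((p.hasDerivAt (Γ.curve s)).comp s hγ).mul (h₂ s hs hsS.2)
    refine h.congr_deriv ?_
    simp only [Function.comp_apply]
    ring
  have hi := fun p : ℂ[X] => Integrable.sub
    (Arc.curveIntegrable_eval_mul hw.moments (derivative p)) (hv p)
  -- On an unbounded curve, `w → 0` alone does not give `p w → 0`. The identity `(p w)² = (p² w) w`
  -- does, because `p² w` also has finite end limits.
  have h := Γ.integral_deriv_eq_zero (hS₁.union hS₂) (hc p) (hd p) (hi p) (hc (p * p))
    (hd (p * p)) (hi (p * p)) (g := fun s => w (Γ.curve s))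
    (fun s => by rw [eval_mul]; ring) hw.vanish_start hw.vanish_end
  rw [integral_sub (Arc.curveIntegrable_eval_mul hw.moments (derivative p)) (hv p),
    sub_eq_zero] at h
  exact h

/-- The ladder functional `p ↦ ∫ p(t) (v'(t) - v'(x)) / (t - x) w(t) dt` evaluated at a multiple
of `t - x`. -/
lemma IsWeight.functional_X_sub_C_mul {Γ : Arc} {w v' : ℂ → ℂ} (hw : IsWeight Γ w v') (x : ℂ)
    (hx : ∀ m : ℕ, Γ.CurveIntegrable fun t => t ^ m * ((v' t - v' x) / (t - x) * w t))
    (p : ℂ[X]) :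
    Γ.functional (fun t => (v' t - v' x) / (t - x) * w t) hx ((X - C x) * p) =
      Γ.functional w hw.moments (derivative p) - v' x * Γ.functional w hw.moments p := by
  have hcancel : ∀ p : ℂ[X], (fun s => ((X - C x) * p).eval (Γ.curve s) *
      ((v' (Γ.curve s) - v' x) / (Γ.curve s - x) * w (Γ.curve s)) * deriv Γ.curve s)
      =ᵐ[volume.restrict Γ.params] fun s => (p.eval (Γ.curve s) * (v' (Γ.curve s) *
        w (Γ.curve s)) * deriv Γ.curve s) -
        (v' x * (p.eval (Γ.curve s) * w (Γ.curve s) * deriv Γ.curve s)) := by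
    intro p
    filter_upwards [Γ.ae_curve_ne x] with s hs
    have := sub_ne_zero.2 hs
    simp only [eval_mul, eval_sub, eval_X, eval_C]
    field_simp
  have hmom := fun p => Arc.curveIntegrable_eval_mul hw.moments p
  -- Convergence of the integrals of `p v' w` is not assumed separately: it follows from the ladder
  -- integral of `(t - x) p` and the moments.
  have hv : ∀ p : ℂ[X], Γ.CurveIntegrable fun t => p.eval t * (v' t * w t) := by
    intro p
    have h := ((Integrable.congr (Arc.curveIntegrable_eval_mul hx ((X - C x) * p))
      (hcancel p))).add (Integrable.const_mul (hmom p) (v' x))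
    refine h.congr (Eventually.of_forall fun s => ?_)
    simp
  rw [hw.integral_derivative hv, Arc.functional_apply, Arc.functional_apply, Arc.integral,
    integral_congr_ae (hcancel p), integral_sub (hv p) (Integrable.const_mul (hmom p) (v' x)),
    integral_const_mul]
  rfl

end MOP

namespace MOP
open Polynomial

variable {r : ℕ} {Γ : Fin r → Arc} {w : Fin r → ℂ → ℂ} {L : Fin r → ℂ[X] →ₗ[ℂ] ℂ}

/-! ### The transfer matrix acts on type II and on type I polynomials -/

/-- The tuples of type I polynomials dual to the entries of `vecP`. -/
noncomputable def vecQ (Γ : Fin r → Arc) (w : Fin r → ℂ → ℂ) (m : Fin r → ℕ) (i : Fin (r + 1))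
    (k : Fin r) : ℂ[X] :=
  Fin.cases (-A Γ w m k) (fun j => C (a Γ w m j) * A Γ w (up m j) k) i

lemma vecP_zero (m : Fin r → ℕ) : vecP Γ w m 0 = P Γ w m := rfl

lemma vecP_succ (m : Fin r → ℕ) (j : Fin r) : vecP Γ w m j.succ = P Γ w (down m j) := rfl

lemma vecQ_zero (m : Fin r → ℕ) (k : Fin r) : vecQ Γ w m 0 k = -A Γ w m k := rfl

lemma vecQ_succ (m : Fin r → ℕ) (j k : Fin r) :
    vecQ Γ w m j.succ k = C (a Γ w m j) * A Γ w (up m j) k := rfl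

lemma W_zero_zero (n : Fin r → ℕ) (l : Fin r) : W Γ w n l 0 0 = X - C (b Γ w n l) := rfl

lemma W_zero_succ (n : Fin r → ℕ) (l j : Fin r) : W Γ w n l 0 j.succ = -C (a Γ w n j) := rfl

lemma W_succ_zero (n : Fin r → ℕ) (l i : Fin r) : W Γ w n l i.succ 0 = 1 := rfl

lemma W_succ_succ (n : Fin r → ℕ) (l i j : Fin r) :
    W Γ w n l i.succ j.succ = if i = j then C (B Γ w n l i) else 0 := rfl

lemma W_eq (n : Fin r → ℕ) (l : Fin r) (x : ℂ) (i j : Fin (r + 1)) :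
    W Γ w n l i j = C ((W Γ w n l i j).eval x) + if i = 0 ∧ j = 0 then X - C x else 0 := by
  refine Fin.cases (Fin.cases ?_ (fun j => ?_) j) (fun i => Fin.cases ?_ (fun j => ?_) j) i
  · simp [W_zero_zero]
  · simp [W_zero_succ]
  · simp [W_succ_zero]
  · rw [W_succ_succ]
    split_ifs <;> simp_all

lemma derivative_W (n : Fin r → ℕ) (l : Fin r) (i j : Fin (r + 1)) :
    derivative (W Γ w n l i j) = if i = 0 ∧ j = 0 then 1 else 0 := by
  rw [W_eq n l 0 i j]
  split_ifs <;> simp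

/-- Freezing `W` at `x` costs only the corner term, as all other entries of `W` are constant. -/
lemma map_sum_W_mul (ℓ : ℂ[X] →ₗ[ℂ] ℂ) (n : Fin r → ℕ) (l : Fin r) (x : ℂ) (i : Fin (r + 1))
    (V : Fin (r + 1) → ℂ[X]) :
    ℓ (∑ j, W Γ w n l i j * V j) = ∑ j, (W Γ w n l i j).eval x * ℓ (V j) +
      if i = 0 then ℓ ((X - C x) * V 0) else 0 := by
  have h : ∀ j, W Γ w n l i j * V j = (W Γ w n l i j).eval x • V j +
      if j = 0 then if i = 0 then (X - C x) * V 0 else 0 else 0 := by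
    intro j
    nth_rewrite 1 [W_eq n l x i j]
    rw [add_mul, smul_eq_C_mul]
    by_cases hj : j = 0
    · by_cases hi : i = 0 <;> simp [hi, hj]
    · simp [hj]
  rw [Finset.sum_congr rfl fun j _ => h j, Finset.sum_add_distrib, map_add, map_sum,
    Finset.sum_ite_eq', if_pos (Finset.mem_univ _), apply_ite ℓ, map_zero]
  simp only [map_smul, smul_eq_mul]

lemma map_sum_mul_W (ℓ : ℂ[X] →ₗ[ℂ] ℂ) (n : Fin r → ℕ) (l : Fin r) (x : ℂ) (j : Fin (r + 1))
    (V : Fin (r + 1) → ℂ[X]) :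
    ℓ (∑ i, V i * W Γ w n l i j) = ∑ i, ℓ (V i) * (W Γ w n l i j).eval x +
      if j = 0 then ℓ ((X - C x) * V 0) else 0 := by
  have h : ∀ i, V i * W Γ w n l i j = (W Γ w n l i j).eval x • V i +
      if i = 0 then if j = 0 then (X - C x) * V 0 else 0 else 0 := by
    intro i
    nth_rewrite 1 [W_eq n l x i j]
    rw [mul_comm, add_mul, smul_eq_C_mul]
    by_cases hj : j = 0
    · by_cases hi : i = 0 <;> simp [hi, hj]
    · simp [hj]
  rw [Finset.sum_congr rfl fun i _ => h i, Finset.sum_add_distrib, map_add, map_sum,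
    Finset.sum_ite_eq', if_pos (Finset.mem_univ _), apply_ite ℓ, map_zero]
  simp only [map_smul, smul_eq_mul, mul_comm]

section

variable (hL : ∀ k, polyInt Γ w k = L k) (hnormal : ∀ m, IsNormal Γ w m)
include hL hnormal

lemma vecP_up {n : Fin r → ℕ} (hn : ∀ j, 1 ≤ n j) (l : Fin r) :
    vecP Γ w (up n l) = W Γ w n l *ᵥ vecP Γ w n := by
  ext1 i
  rw [Matrix.mulVec, dotProduct, Fin.sum_univ_succ]
  refine Fin.cases ?_ (fun i => ?_) i
  · simp only [vecP_zero, vecP_succ, W_zero_zero, W_zero_succ, P_up hL hnormal hn, neg_mul,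
      Finset.sum_neg_distrib, sub_eq_add_neg]
  · simp only [vecP_zero, vecP_succ, W_succ_zero, W_succ_succ, P_up_down hL hnormal (hn i), ite_mul,
      zero_mul, one_mul, Finset.sum_ite_eq, Finset.mem_univ, if_true]

/-- Column `0` is `X_mul_A_up` and the other columns are `C_a_mul_A_up`; the sign and the factors
`a` in `vecQ` make both fit the same `W`. -/
lemma vecQ_eq_sum {n : Fin r → ℕ} (hn : ∀ j, 1 ≤ n j) (l k : Fin r) (j : Fin (r + 1)) :
    vecQ Γ w n j k = ∑ i, vecQ Γ w (up n l) i k * W Γ w n l i j := by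
  rw [Fin.sum_univ_succ]
  refine Fin.cases ?_ (fun j => ?_) j
  · simp only [vecQ_zero, vecQ_succ, W_zero_zero, W_succ_zero, mul_one]
    linear_combination X_mul_A_up hL hnormal l hn k
  · simp only [vecQ_zero, vecQ_succ, W_zero_succ, W_succ_succ, mul_ite, mul_zero,
      Finset.sum_ite_eq', Finset.mem_univ, if_true, C_a_mul_A_up hL hnormal (hn j) l k, C_mul]
    ring

/-! ### Evaluation of the corner terms by biorthogonality. -/

/-- In the product rule the term with `A'` dies by orthogonality of `P`, and the type I tuple reads
off the leading coefficient `size m` of `P'`. -/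
lemma sum_map_derivative_zero_zero (m : Fin r → ℕ) :
    ∑ k, L k (derivative (vecP Γ w m 0 * vecQ Γ w m 0 k)) = -size m := by
  have h : ∀ k, L k (derivative (vecP Γ w m 0 * vecQ Γ w m 0 k)) =
      -L k (derivative (P Γ w m) * A Γ w m k) := by
    intro k
    rw [vecP_zero, vecQ_zero, derivative_mul, map_add, mul_neg, map_neg, derivative_neg, mul_neg,
      map_neg,
      map_P_mul hL hnormal m k (degree_derivative_le.trans_lt (degree_A_lt hL hnormal m k)),
      neg_zero, add_zero]
  have hd : (derivative (P Γ w m)).degree < size m := by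
    rw [degree_lt_iff_coeff_zero]
    intro i hi
    rw [coeff_derivative, coeff_eq_zero_of_degree_lt, zero_mul]
    exact degree_lt_of_lt_of_le (degree_P_lt hL hnormal m) (by omega)
  rw [Finset.sum_congr rfl fun k _ => h k, Finset.sum_neg_distrib,
    sum_map_mul_A hL hnormal m hd, coeff_derivative]
  rcases Nat.eq_zero_or_pos (size m) with h0 | h0
  · have hP : P Γ w m = 1 := (monic_P hL hnormal m).natDegree_eq_zero.1
      (by rw [natDegree_P hL hnormal, h0])
    simp [h0, hP, coeff_one]
  · rw [Nat.sub_add_cancel h0, coeff_P_size hL hnormal, one_mul, ← Nat.cast_succ,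
      Nat.succ_eq_add_one, Nat.sub_add_cancel h0]

/-- Differentiating `A` brings its degree back into the orthogonality range of `P`, while `P'` has
too small a degree to be seen by the tuple at `up m j`. -/
lemma sum_map_derivative_mul_A_up (m : Fin r → ℕ) (j : Fin r) :
    ∑ k, L k (derivative (P Γ w m * A Γ w (up m j) k)) = 0 := by
  have h : ∀ k, L k (derivative (P Γ w m * A Γ w (up m j) k)) =
      L k (derivative (P Γ w m) * A Γ w (up m j) k) := by
    intro k
    rw [derivative_mul, map_add, map_P_mul hL hnormal m k (q := derivative _), add_zero]
    rw [degree_lt_iff_coeff_zero]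
    intro i hi
    rw [coeff_derivative, coeff_eq_zero_of_degree_lt, zero_mul]
    refine degree_lt_of_lt_of_le (degree_A_lt hL hnormal (up m j) k) ?_
    rcases eq_or_ne k j with rfl | hk
    · rw [up_same]; omega
    · rw [up_of_ne _ hk]; omega
  have hd : ∀ i, size m ≤ i → (derivative (P Γ w m)).coeff i = 0 := by
    intro i hi
    rw [coeff_derivative, coeff_eq_zero_of_degree_lt, zero_mul]
    exact degree_lt_of_lt_of_le (degree_P_lt hL hnormal m) (by omega)
  rw [Finset.sum_congr rfl fun k _ => h k, sum_map_mul_A hL hnormal (up m j), size_up,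
    Nat.add_sub_cancel, hd _ le_rfl]
  rw [size_up, degree_lt_iff_coeff_zero]
  exact fun i hi => hd i (by omega)

lemma sum_ladder_zero_zero (m : Fin r → ℕ) (c : Fin r → ℂ) :
    ∑ k, (L k (derivative (vecP Γ w m 0 * vecQ Γ w m 0 k)) -
      c k * L k (vecP Γ w m 0 * vecQ Γ w m 0 k)) = -size m := by
  rw [Finset.sum_sub_distrib, sum_map_derivative_zero_zero hL hnormal, Finset.sum_eq_zero, sub_zero]
  intro k _
  rw [vecP_zero, vecQ_zero, mul_neg, map_neg, map_P_mul_A hL hnormal, neg_zero, mul_zero]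

lemma sum_ladder_up (m : Fin r → ℕ) (c : Fin r → ℂ) (j : Fin r) :
    ∑ k, (L k (derivative (P Γ w m * A Γ w (up m j) k)) -
      c k * L k (P Γ w m * A Γ w (up m j) k)) = -c j := by
  rw [Finset.sum_sub_distrib, sum_map_derivative_mul_A_up hL hnormal]
  simp [map_P_mul_A_up hL hnormal]

lemma sum_ladder_zero_succ (m : Fin r → ℕ) (c : Fin r → ℂ) (j : Fin r) :
    ∑ k, (L k (derivative (vecP Γ w m 0 * vecQ Γ w m j.succ k)) -
      c k * L k (vecP Γ w m 0 * vecQ Γ w m j.succ k)) = -(a Γ w m j * c j) := by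
  rw [← mul_neg, ← sum_ladder_up hL hnormal m c j, Finset.mul_sum]
  refine Finset.sum_congr rfl fun k _ => ?_
  rw [vecP_zero, vecQ_succ, mul_left_comm, ← smul_eq_C_mul, derivative_smul, map_smul, map_smul,
    smul_eq_mul, smul_eq_mul]
  ring

lemma sum_ladder_succ_zero {m : Fin r → ℕ} {i : Fin r} (hi : 1 ≤ m i) (c : Fin r → ℂ) :
    ∑ k, (L k (derivative (vecP Γ w m i.succ * vecQ Γ w m 0 k)) -
      c k * L k (vecP Γ w m i.succ * vecQ Γ w m 0 k)) = c i := by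
  have h := sum_ladder_up hL hnormal (down m i) c i
  rw [up_down hi] at h
  rw [← neg_eq_iff_eq_neg.2 h, ← Finset.sum_neg_distrib]
  refine Finset.sum_congr rfl fun k _ => ?_
  rw [vecP_succ, vecQ_zero, mul_neg, derivative_neg, map_neg, map_neg]
  ring

/-- Compatibility for arbitrary functionals `K k` which satisfy the relation that integration by
parts gives for the ladder integrals. -/
lemma compatibility {n : Fin r → ℕ} (hn : ∀ j, 1 ≤ n j) (l : Fin r)
    (K : Fin r → ℂ[X] →ₗ[ℂ] ℂ) (c : Fin r → ℂ) (x : ℂ)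
    (hK : ∀ k p, K k ((X - C x) * p) = L k (derivative p) - c k * L k p)
    (M : (Fin r → ℕ) → Matrix (Fin (r + 1)) (Fin (r + 1)) ℂ)
    (hM : ∀ m i j, M m i j = (∑ k, K k (vecP Γ w m i * vecQ Γ w m j k)) +
      if i = j then (Fin.cases 0 c j : ℂ) else 0) :
    M (up n l) * evalMat (W Γ w n l) x =
      evalMat (derivMat (W Γ w n l)) x + evalMat (W Γ w n l) x * M n := by
  -- Both sides equal the mixed pairing of `vecP` at `up n l` with `vecQ` at `n`, expanded in the
  -- first and in the second factor.
  have key : ∀ i j, (∑ i', (W Γ w n l i i').eval x * ∑ k, K k (vecP Γ w n i' * vecQ Γ w n j k)) +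
      (if i = 0 then ∑ k, K k ((X - C x) * (vecP Γ w n 0 * vecQ Γ w n j k)) else 0) =
      (∑ j', (∑ k, K k (vecP Γ w (up n l) i * vecQ Γ w (up n l) j' k)) *
        (W Γ w n l j' j).eval x) +
      (if j = 0 then ∑ k, K k ((X - C x) * (vecP Γ w (up n l) i * vecQ Γ w (up n l) 0 k))
        else 0) := by
    intro i j
    trans ∑ k, K k (vecP Γ w (up n l) i * vecQ Γ w n j k)
    · have h : ∀ k, vecP Γ w (up n l) i * vecQ Γ w n j k =
          ∑ i', W Γ w n l i i' * (vecP Γ w n i' * vecQ Γ w n j k) := by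
        intro k
        rw [vecP_up hL hnormal hn l, Matrix.mulVec, dotProduct, Finset.sum_mul]
        simp only [mul_assoc]
      simp only [h, map_sum_W_mul _ n l x, Finset.sum_add_distrib, Finset.mul_sum]
      rw [Finset.sum_comm]
      split_ifs <;> simp
    · have h : ∀ k, vecP Γ w (up n l) i * vecQ Γ w n j k =
          ∑ j', vecP Γ w (up n l) i * vecQ Γ w (up n l) j' k * W Γ w n l j' j := by
        intro k
        rw [vecQ_eq_sum hL hnormal hn l, Finset.mul_sum]
        simp only [mul_assoc]
      simp only [h, map_sum_mul_W _ n l x, Finset.sum_add_distrib, Finset.sum_mul]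
      rw [Finset.sum_comm]
      split_ifs <;> simp
  ext i j
  have h := key i j
  simp only [hK] at h
  simp only [Matrix.add_apply, Matrix.mul_apply, evalMat, derivMat, Matrix.map_apply, hM,
    derivative_W, add_mul, mul_add, Finset.sum_add_distrib, ite_mul, mul_ite, zero_mul, mul_zero,
    Finset.sum_ite_eq, Finset.sum_ite_eq', Finset.mem_univ, if_true]
  revert h
  -- In the corner the sizes differ by one, which is the derivative of `W`. In the rest of row and
  -- column `0` the corner term supplies the diagonal contribution of `c`. In the remaining block
  -- there is no corner term, and the diagonal matrices commute.
  refine Fin.cases (Fin.cases ?_ (fun j => ?_) j) (fun i => Fin.cases ?_ (fun j => ?_) j) i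
  · intro h
    simp only [sum_ladder_zero_zero hL hnormal, size_up, if_true] at h
    simp only [Fin.cases_zero, and_self, if_true, eval_one]
    push_cast at h
    linear_combination -h
  · intro h
    simp only [sum_ladder_zero_succ hL hnormal, Fin.succ_ne_zero, if_true, if_false] at h
    simp only [Fin.cases_zero, Fin.cases_succ, Fin.succ_ne_zero, and_false, if_false, eval_zero,
      W_zero_succ, eval_neg, eval_C]
    linear_combination -h
  · intro h
    simp only [sum_ladder_succ_zero hL hnormal ((hn i).trans (le_up n i l)), Fin.succ_ne_zero,
      if_true, if_false] at h
    simp only [Fin.cases_zero, Fin.cases_succ, Fin.succ_ne_zero, false_and, if_false, eval_zero,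
      W_succ_zero, eval_one]
    linear_combination -h
  · intro h
    simp only [Fin.succ_ne_zero, if_false] at h
    have hW : c i * (W Γ w n l i.succ j.succ).eval x = (W Γ w n l i.succ j.succ).eval x * c j := by
      rw [W_succ_succ]
      split_ifs with hij
      · rw [hij, mul_comm]
      · rw [eval_zero, mul_zero, zero_mul]
    simp only [Fin.cases_succ, Fin.succ_ne_zero, false_and, if_false, eval_zero]
    linear_combination -h + hW

end

end MOP

theorem theorem2p3 {r : ℕ} (Γ : Fin r → MOP.Arc) (w v' : Fin r → ℂ → ℂ)
    (hw : ∀ k, MOP.IsWeight (Γ k) (w k) (v' k))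
    (hnormal : ∀ m : Fin r → ℕ, MOP.IsNormal Γ w m)
    (n : Fin r → ℕ) (hn : ∀ j, 1 ≤ n j) (l : Fin r) :
    MOP.vecP Γ w (MOP.up n l) = MOP.W Γ w n l *ᵥ MOP.vecP Γ w n ∧
    ∀ x : ℂ, MOP.IsLadderPoint Γ w v' x →
      MOP.N Γ w v' (MOP.up n l) x * MOP.evalMat (MOP.W Γ w n l) x =
        MOP.evalMat (MOP.derivMat (MOP.W Γ w n l)) x
          + MOP.evalMat (MOP.W Γ w n l) x * MOP.N Γ w v' n x := by
  have hL : ∀ k, MOP.polyInt Γ w k = (Γ k).functional (w k) (hw k).moments := fun k => rfl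
  refine ⟨MOP.vecP_up hL hnormal hn l, fun x hx => ?_⟩
  have hg : ∀ (k : Fin r) (m : ℕ), (Γ k).CurveIntegrable
      fun t => t ^ m * ((v' k t - v' k x) / (t - x) * w k t) := by
    intro k m
    have h := (hx k m).const_mul (-1)
    have e : (fun t => -1 * (t ^ m * ((v' k t - v' k x) / (x - t)) * w k t)) =
        fun t => t ^ m * ((v' k t - v' k x) / (t - x) * w k t) := by
      funext t
      rw [← neg_sub t x, div_neg]
      ring
    rwa [e] at h
  refine MOP.compatibility hL hnormal hn l (fun k => (Γ k).functional _ (hg k)) (v' · x) x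
    (fun k p => (hw k).functional_X_sub_C_mul x (hg k) p) (fun m => MOP.N Γ w v' m x) ?_
  intro m i j
  refine Fin.cases ?_ (fun j => ?_) j
  -- The denominator `x - t` in column `0` accounts for the minus sign in `vecQ`.
  · have e : ∀ k, (fun t => (MOP.P Γ w (MOP.down₀ m i)).eval t * (MOP.A Γ w m k).eval t *
        ((v' k t - v' k x) / (x - t)) * w k t) = fun t =>
        (MOP.vecP Γ w m i * MOP.vecQ Γ w m 0 k).eval t *
          ((v' k t - v' k x) / (t - x) * w k t) := by
      intro k
      funext t
      rw [← neg_sub t x, div_neg, MOP.vecQ_zero, MOP.vecP, Polynomial.eval_mul,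
        Polynomial.eval_neg]
      ring
    simp [MOP.N, MOP.Arc.functional_apply, e]
  · have e : ∀ k, MOP.a Γ w m j * ((Γ k).integral fun t =>
        (MOP.P Γ w (MOP.down₀ m i)).eval t * (MOP.A Γ w (MOP.up m j) k).eval t *
          ((v' k t - v' k x) / (t - x)) * w k t) =
        (Γ k).functional _ (hg k) (MOP.vecP Γ w m i * MOP.vecQ Γ w m j.succ k) := by
      intro k
      rw [MOP.vecQ_succ, mul_left_comm, ← Polynomial.smul_eq_C_mul, map_smul, smul_eq_mul,
        MOP.Arc.functional_apply]
      simp only [MOP.vecP, Polynomial.eval_mul, mul_assoc]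
    simp only [← e]
    simp [MOP.N, Finset.mul_sum]
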